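/- Let $A=(a_{ij})\in\mathbb{R}^{n\times n}$ be a system matrix, let $C_i\in\mathbb{R}^{p_i\times n}$ $(i=1,\dots,N)$ be the output matrices of $N$ agents, and let $C=(c_{ij})$ be the matrix obtained by stacking $C_1,\dots,C_N$. The system digraph has as vertices the states $x_1,\dots,x_n$ and the outputs $y_1,\dots,y_p$ ($p=p_1+\dots+p_N$), an edge $x_j\to x_i$ whenever $a_{ij}\ne 0$, and an edge $x_j\to y_i$ whenever $c_{ij}\neq 0$. A parent SCC is a strongly connected component consisting of states that has no edge to a state outside it; it is monitored by an agent if there is an edge from one of its states to an output of that agent. The structural rank of $A$ is the maximum of the ranks of all real matrices with the same zero/non-zero pattern as $A$. The pair $(A,C)$ is generically observable if, when the non-zero entries of $A$ and $C$ are regarded as independent free real parameters, the observability matrix $[C^T\; A^TC^T\;\cdots\;(A^{n-1})^TC^T]$ has rank $n$ for all parameter values outside an algebraic variety of Lebesgue measure zero. Suppose that $A$ has full structural rank, i.e. structural rank $n$. Then $(A,C)$ is generically observable if and only if every parent SCC of the system digraph is monitored by at least one agent. -/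

import Mathlib

namespace StructuredSystem

noncomputable section

/-! ### Observability -/

/-- The observability matrix `[Cᵀ, AᵀCᵀ, …, (Aᵀ)ⁿ⁻¹Cᵀ]` of the pair `(A, C)`; the column
indexed by `(k, y)` is the `y`-th column of `(Aᵀ)ᵏ Cᵀ`. -/
def observabilityMatrix {n : ℕ} {Y : Type} (A : Matrix (Fin n) (Fin n) ℝ)
    (C : Matrix Y (Fin n) ℝ) : Matrix (Fin n) (Fin n × Y) ℝ :=
  Matrix.of fun x ky => (A.transpose ^ (ky.1 : ℕ) * C.transpose) x ky.2

/-- `(A, C)` is observable: the observability matrix has full rank `n`. -/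
def IsObservable {n : ℕ} {Y : Type} [Fintype Y] (A : Matrix (Fin n) (Fin n) ℝ)
    (C : Matrix Y (Fin n) ℝ) : Prop :=
  (observabilityMatrix A C).rank = n

/-! ### Structure of matrices and generic properties -/

/-- Two matrices have the same structure (zero / non-zero pattern). -/
def SameStructure {R X : Type} (M M' : Matrix R X ℝ) : Prop :=
  ∀ r x, M' r x = 0 ↔ M r x = 0

/-- The structural rank: the maximum of the ranks of all matrices with the structure of `M`.
(The set is nonempty and bounded by the number of columns, so the supremum is a maximum.) -/
def sRank {R X : Type} [Fintype X] (M : Matrix R X ℝ) : ℕ :=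
  sSup {k | ∃ M' : Matrix R X ℝ, SameStructure M M' ∧ M'.rank = k}

/-- The positions of the non-zero entries of `M`. -/
abbrev Support {R X : Type} (M : Matrix R X ℝ) : Type :=
  {e : R × X // M e.1 e.2 ≠ 0}

/-- The free parameters of the structured pair `(A, C)`: one for each non-zero entry of `A`
and one for each non-zero entry of `C`. -/
abbrev Param {n : ℕ} {Y : Type} (A : Matrix (Fin n) (Fin n) ℝ) (C : Matrix Y (Fin n) ℝ) : Type :=
  Support A ⊕ Support C

/-- Put the values `θ` at the non-zero positions of `M`, and `0` at all other positions. -/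
def fill {R X : Type} (M : Matrix R X ℝ) (θ : Support M → ℝ) : Matrix R X ℝ :=
  Matrix.of fun r x => if h : M r x ≠ 0 then θ ⟨(r, x), h⟩ else 0

/-- `(A, C)` is generically observable: the pairs with the structure of `(A, C)` are observable
for almost all values of the free parameters, in the sense that all exceptional parameter values
lie on an algebraic variety of Lebesgue measure zero in the parameter space.
This depends only on the zero / non-zero patterns of `A` and `C`. -/
def GenericallyObservable {n : ℕ} {Y : Type} [Fintype Y] (A : Matrix (Fin n) (Fin n) ℝ)
    (C : Matrix Y (Fin n) ℝ) : Prop :=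
  ∃ q : MvPolynomial (Param A C) ℝ,
    MeasureTheory.volume {θ : Param A C → ℝ | MvPolynomial.eval θ q = 0} = 0 ∧
    ∀ θ : Param A C → ℝ, MvPolynomial.eval θ q ≠ 0 →
      IsObservable (fill A fun e => θ (Sum.inl e)) (fill C fun e => θ (Sum.inr e))

/-! ### The system digraph and its strongly connected components -/

/-- The system digraph on states and outputs: `x_j → x_i` iff `a_ij ≠ 0`, and
`x_j → y_i` iff `c_ij ≠ 0`; outputs have no outgoing edges. -/
def systemDigraph {n : ℕ} {Y : Type} (A : Matrix (Fin n) (Fin n) ℝ) (C : Matrix Y (Fin n) ℝ) :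
    Digraph (Fin n ⊕ Y) where
  Adj u v := match u, v with
    | Sum.inl j, Sum.inl i => A i j ≠ 0
    | Sum.inl j, Sum.inr y => C y j ≠ 0
    | Sum.inr _, _ => False

/-- The subgraph of `G` induced on `S` is strongly connected: it has a directed path from each
vertex to every other vertex. -/
def IsStronglyConnectedOn {V : Type} (G : Digraph V) (S : Set V) : Prop :=
  ∀ u ∈ S, ∀ v ∈ S, Relation.ReflTransGen (fun a b => a ∈ S ∧ b ∈ S ∧ G.Adj a b) u v

/-- Strongly connected components: the maximal nonempty strongly connected vertex sets. -/
def IsSCC {V : Type} (G : Digraph V) (S : Set V) : Prop :=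
  Maximal (fun T : Set V => T.Nonempty ∧ IsStronglyConnectedOn G T) S

/-- `K` is a parent SCC: a state SCC without outgoing edge to a state outside `K`. -/
def IsParentSCC {n : ℕ} {Y : Type} (A : Matrix (Fin n) (Fin n) ℝ) (C : Matrix Y (Fin n) ℝ)
    (K : Set (Fin n)) : Prop :=
  IsSCC (systemDigraph A C) (Sum.inl '' K) ∧
    ∀ u ∈ K, ∀ v, v ∉ K → ¬ (systemDigraph A C).Adj (Sum.inl u) (Sum.inl v)

/-! ### Agents -/

/-- The global output matrix: the output matrices `C i` of all agents stacked. -/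
def globalOutput {n N : ℕ} {p : Fin N → ℕ} (C : ∀ i : Fin N, Matrix (Fin (p i)) (Fin n) ℝ) :
    Matrix (Σ i : Fin N, Fin (p i)) (Fin n) ℝ :=
  Matrix.of fun y x => C y.1 y.2 x

/-- Agent `i` monitors `K`: there is an edge of the system digraph from a state of `K` to an
output of agent `i`. -/
def Monitors {n N : ℕ} {p : Fin N → ℕ} (A : Matrix (Fin n) (Fin n) ℝ)
    (C : ∀ i : Fin N, Matrix (Fin (p i)) (Fin n) ℝ) (i : Fin N) (K : Set (Fin n)) : Prop :=
  ∃ x ∈ K, ∃ r : Fin (p i),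
    (systemDigraph A (globalOutput C)).Adj (Sum.inl x) (Sum.inr ⟨i, r⟩)

end

end StructuredSystem

/-! Necessity: an unmonitored parent SCC spans, for all parameter values, an invariant subspace
killed by the output map, while generic observability yields at least one observable pair.

Sufficiency: observability means `det (O Oᵀ) ≠ 0`, a polynomial condition on the parameters, so one
observable pair supported in the pattern suffices; zeros at allowed positions do no harm. A nonzero
Leibniz term of a full-rank realization covers the states by disjoint cycles. Every state reaches a
parent SCC, hence an output, so each cycle can be given one exit edge that decreases the distance to
the outputs. Keep only these edges, with a different weight on each cycle.

By the eigenvector test it remains to prove `eigenvector_eq_zero`. On the farthest level where an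
unobservable eigenvector lives nothing feeds its cycle, so the modulus of the eigenvalue is that
cycle's weight. Every other unfed cycle has a different weight and carries nothing. The eigenvector
thus descends along a single chain of cycles and reaches an output without cancellation, a
contradiction. -/

/-! ### Zero sets of polynomials -/

open MeasureTheory in
/-- The zero set of a nonzero real polynomial in `n` variables is a Lebesgue null set. -/
theorem MvPolynomial.volume_zeros_fin : ∀ (n : ℕ) (q : MvPolynomial (Fin n) ℝ), q ≠ 0 →
    volume {x : Fin n → ℝ | MvPolynomial.eval x q = 0} = 0 := by
  intro n
  induction n with
  | zero =>
    intro q hq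
    have : {x : Fin 0 → ℝ | MvPolynomial.eval x q = 0} = ∅ := by
      refine Set.eq_empty_iff_forall_notMem.2 fun x hx => hq (MvPolynomial.funext fun y => ?_)
      rw [Subsingleton.elim y x, map_zero]
      exact hx
    rw [this, measure_empty]
  | succ n ih =>
    intro q hq
    let e := MeasurableEquiv.piFinSuccAbove (fun _ : Fin (n + 1) => ℝ) 0
    have he := volume_preserving_piFinSuccAbove (fun _ : Fin (n + 1) => ℝ) 0
    let S : Set (ℝ × (Fin n → ℝ)) :=
      {z | MvPolynomial.eval (Fin.cons z.1 z.2 : Fin (n + 1) → ℝ) q = 0}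
    have hcont : Continuous fun z : ℝ × (Fin n → ℝ) =>
        MvPolynomial.eval (Fin.cons z.1 z.2 : Fin (n + 1) → ℝ) q := by
      refine (MvPolynomial.continuous_eval q).comp (continuous_pi fun i => ?_)
      refine Fin.cases ?_ (fun i => ?_) i
      · simpa using continuous_fst
      · simpa [Function.comp_def] using (continuous_apply i).comp continuous_snd
    have hS : MeasurableSet S := (isClosed_singleton.preimage hcont).measurableSet
    have hpre : {x : Fin (n + 1) → ℝ | MvPolynomial.eval x q = 0} = e ⁻¹' S := by
      ext x
      have : (Fin.cons (e x).1 (e x).2 : Fin (n + 1) → ℝ) = x := by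
        funext i
        refine Fin.cases ?_ (fun i => ?_) i <;> simp [e, MeasurableEquiv.piFinSuccAbove,
          Fin.insertNthEquiv, Fin.tail]
      simp only [S, Set.mem_ofPred_eq, Set.mem_preimage, this]
    rw [hpre, he.measure_preimage hS.nullMeasurableSet]
    refine (Measure.measure_prod_null hS).2 ?_
    have hq' : MvPolynomial.finSuccEquiv ℝ n q ≠ 0 := by simpa using hq
    -- Fubini over the first coordinate: only finitely many values `y` make the slice of `q` at `y`
    -- the zero polynomial.
    have hfin : {y : ℝ | Polynomial.eval (MvPolynomial.C y)
        (MvPolynomial.finSuccEquiv ℝ n q) = 0}.Finite := by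
      refine Set.Finite.preimage (f := fun y : ℝ => (MvPolynomial.C y : MvPolynomial (Fin n) ℝ))
        (MvPolynomial.C_injective (Fin n) ℝ).injOn (s := {z | Polynomial.eval z
        (MvPolynomial.finSuccEquiv ℝ n q) = 0}) ?_
      exact (Polynomial.finite_setOfPred_isRoot hq')
    filter_upwards [compl_mem_ae_iff.2 (hfin.measure_zero volume)] with y hy
    have := ih _ hy
    refine (measure_mono fun x hx => ?_).trans this.le |>.antisymm (zero_le)
    have hx : MvPolynomial.eval (Fin.cons y x : Fin (n + 1) → ℝ) q = 0 := hx
    have h2 := Polynomial.eval₂_at_apply (p := MvPolynomial.finSuccEquiv ℝ n q)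
      (MvPolynomial.eval x) (MvPolynomial.C y)
    rw [MvPolynomial.eval_C] at h2
    rw [MvPolynomial.eval_eq_eval_mv_eval', Polynomial.eval_map, h2] at hx
    exact hx

open MeasureTheory in
/-- The zero set of a nonzero real polynomial is a Lebesgue null set. -/
theorem MvPolynomial.volume_zeros {ι : Type*} [Fintype ι] (q : MvPolynomial ι ℝ) (hq : q ≠ 0) :
    volume {x : ι → ℝ | MvPolynomial.eval x q = 0} = 0 := by
  let e := Fintype.equivFin ι
  have hp := volume_measurePreserving_piCongrLeft (fun _ => ℝ) e
  have h := MvPolynomial.volume_zeros_fin _ (MvPolynomial.rename e q)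
    (by simpa using (MvPolynomial.rename_injective e e.injective).ne hq)
  rw [← hp.measure_preimage_equiv] at h
  have hset : {x : ι → ℝ | MvPolynomial.eval x q = 0} =
      MeasurableEquiv.piCongrLeft (fun _ => ℝ) e ⁻¹'
        {x | MvPolynomial.eval x (MvPolynomial.rename e q) = 0} := by
    ext x
    have : (MeasurableEquiv.piCongrLeft (fun _ => ℝ) e x) ∘ e = x := by
      funext i
      exact Equiv.piCongrLeft_apply_apply (fun _ => ℝ) e x i
    simp only [Set.mem_preimage, Set.mem_ofPred_eq, MvPolynomial.eval_rename, this]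
  rw [hset, h]

/-! ### Criteria for observability -/

namespace StructuredSystem

/-- The Gramian criterion: a pair is observable iff `O Oᵀ` is nonsingular. -/
theorem isObservable_iff_det_ne_zero {n : ℕ} {Y : Type} [Fintype Y]
    (A : Matrix (Fin n) (Fin n) ℝ) (C : Matrix Y (Fin n) ℝ) :
    IsObservable A C ↔
      (observabilityMatrix A C * (observabilityMatrix A C).transpose).det ≠ 0 := by
  unfold IsObservable
  rw [← Matrix.rank_self_mul_transpose]
  set M := observabilityMatrix A C * (observabilityMatrix A C).transpose
  refine ⟨fun h h0 => ?_, fun h => by simpa using Matrix.rank_of_det_ne_zero h⟩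
  obtain ⟨v, hv, hMv⟩ := Matrix.exists_mulVec_eq_zero_iff.2 h0
  have hr : LinearMap.range M.mulVecLin = ⊤ := Submodule.eq_top_of_finrank_eq (by
    simpa [Matrix.rank] using h)
  have hi := LinearMap.injective_iff_surjective.2 (LinearMap.range_eq_top.1 hr)
  exact hv (hi (by simpa using hMv))

theorem transpose_observabilityMatrix_mulVec {n : ℕ} {Y : Type} [Fintype Y]
    (A : Matrix (Fin n) (Fin n) ℝ) (C : Matrix Y (Fin n) ℝ) (v : Fin n → ℝ) (k : Fin n) (y : Y) :
    ((observabilityMatrix A C).transpose.mulVec v) (k, y) =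
      (C.mulVec ((A ^ (k : ℕ)).mulVec v)) y := by
  rw [Matrix.mulVec_mulVec]
  simp only [Matrix.mulVec, dotProduct, Matrix.transpose_apply, observabilityMatrix,
    Matrix.of_apply, ← Matrix.transpose_pow, ← Matrix.transpose_mul]

/-- A pair is observable iff its unobservable subspace is trivial. -/
theorem isObservable_iff_forall_mulVec {n : ℕ} {Y : Type} [Fintype Y]
    (A : Matrix (Fin n) (Fin n) ℝ) (C : Matrix Y (Fin n) ℝ) :
    IsObservable A C ↔
      ∀ v : Fin n → ℝ, (∀ k : ℕ, C.mulVec ((A ^ k).mulVec v) = 0) → v = 0 := by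
  rw [isObservable_iff_det_ne_zero, ← not_iff_not, not_not, ← Matrix.exists_mulVec_eq_zero_iff]
  push Not
  have key : ∀ v : Fin n → ℝ,
      (observabilityMatrix A C * (observabilityMatrix A C).transpose).mulVec v = 0 ↔
      ∀ k : ℕ, C.mulVec ((A ^ k).mulVec v) = 0 := by
    intro v
    have h1 : (observabilityMatrix A C * (observabilityMatrix A C).transpose).mulVec v = 0 ↔
        (observabilityMatrix A C).transpose.mulVec v = 0 := by
      have := Matrix.conjTranspose_mul_self_mulVec_eq_zero (observabilityMatrix A C).transpose v
      simpa [Matrix.conjTranspose_eq_transpose_of_trivial] using this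
    rw [h1]
    constructor
    · intro h k
      have hlow : ∀ m < n, C.mulVec ((A ^ m).mulVec v) = 0 := by
        intro m hm
        funext y
        rw [← transpose_observabilityMatrix_mulVec A C v ⟨m, hm⟩ y, h]
        rfl
      -- Cayley–Hamilton reduces every power to those below `n`.
      rw [Matrix.pow_eq_aeval_mod_charpoly]
      rcases Nat.eq_zero_or_pos n with rfl | hn
      · simp [Subsingleton.elim v 0]
      have hdeg : (Polynomial.X ^ k %ₘ A.charpoly).natDegree < n := by
        have := Polynomial.natDegree_modByMonic_lt (Polynomial.X ^ k) A.charpoly_monic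
          (by intro h1; have := A.charpoly_natDegree_eq_dim; rw [h1] at this; simp at this; omega)
        simpa [A.charpoly_natDegree_eq_dim] using this
      rw [Polynomial.aeval_eq_sum_range' hdeg, Matrix.sum_mulVec, Matrix.mulVec_sum]
      refine Finset.sum_eq_zero fun m hm => ?_
      rw [Matrix.smul_mulVec, Matrix.mulVec_smul, hlow m (Finset.mem_range.1 hm), smul_zero]
    · intro h
      funext ⟨k, y⟩
      rw [transpose_observabilityMatrix_mulVec, h]
      rfl
  exact exists_congr fun v => by rw [key]; exact and_comm

end StructuredSystem
-- Eigenvectors on weighted cycles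
namespace StructuredSystem

/-- Along one cycle of `σ`, a solution of `lam * v (σ j) = w * v j` with at most one perturbed
position `t` either vanishes identically or has no zero. -/
theorem cycle_dichotomy {ι : Type*} [Finite ι] (σ : Equiv.Perm ι) (lam w : ℂ) (hlam : lam ≠ 0)
    (hw : w ≠ 0) (v : ι → ℂ) (t : ι)
    (h : ∀ j, σ.SameCycle t j → σ j ≠ t → lam * v (σ j) = w * v j) (j : ι)
    (hj : σ.SameCycle t j) : v j = 0 ↔ v t = 0 := by
  obtain ⟨k, rfl⟩ := hj.exists_nat_pow_eq
  clear hj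
  induction k with
  | zero => simp
  | succ k ih =>
    rw [pow_succ', Equiv.Perm.mul_apply]
    -- The recursion may fail only on the step back into `t`, where the claim is trivial.
    by_cases hk : σ ((σ ^ k) t) = t
    · rw [hk]
    · rw [← ih]
      have := h _ ⟨k, by simp⟩ hk
      constructor
      · intro h0
        rw [h0, mul_zero] at this
        exact (mul_eq_zero.1 this.symm).resolve_left hw
      · intro h0
        rw [h0, mul_zero] at this
        exact (mul_eq_zero.1 this).resolve_left hlam

/-- A nonzero solution of `lam * v (σ j) = w * v j` along a cycle of `σ` forces `‖lam‖ = w`. -/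
theorem cycle_norm_eq {ι : Type*} [Finite ι] (σ : Equiv.Perm ι) (lam : ℂ) (w : ℝ)
    (hw : 0 < w) (v : ι → ℂ) (t : ι) (ht : v t ≠ 0)
    (h : ∀ j, σ.SameCycle t j → lam * v (σ j) = w * v j) : ‖lam‖ = w := by
  have key : ∀ k : ℕ, lam ^ k * v ((σ ^ k) t) = (w : ℂ) ^ k * v t := by
    intro k
    induction k with
    | zero => simp
    | succ k ih =>
      have := h ((σ ^ k) t) ⟨k, by simp⟩
      rw [pow_succ' σ, Equiv.Perm.mul_apply, pow_succ lam, mul_assoc, this, mul_left_comm, ih]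
      ring
  have h1 := key (orderOf σ)
  rw [pow_orderOf_eq_one, Equiv.Perm.one_apply] at h1
  have h2 := congrArg norm (mul_right_cancel₀ ht h1)
  rw [norm_pow, norm_pow, Complex.norm_real, Real.norm_of_nonneg hw.le] at h2
  exact (pow_left_inj₀ (norm_nonneg _) hw.le (orderOf_pos σ).ne').1 h2

/-- Weighted disjoint cycles with pairwise different weights, joined by a forest of edges that
leads to the outputs, have no eigenvector in the kernel of the output map. The cycle of `k` leaves
through the state `s k`, which is joined to `T k`; `D` is the distance to the outputs. -/
theorem eigenvector_eq_zero {ι Y : Type*} [Fintype ι] [DecidableEq ι] [DecidableEq Y]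
    (σ : Equiv.Perm ι) (w : ι → ℝ) (hw0 : ∀ i, 0 < w i)
    (hw : ∀ i j, w i = w j ↔ σ.SameCycle i j) (s : ι → ι) (hs : ∀ i, σ.SameCycle i (s i))
    (hs' : ∀ i j, σ.SameCycle i j → s i = s j) (T : ι → ι ⊕ Y)
    (hT : ∀ i j, σ.SameCycle i j → T i = T j) (D : ι ⊕ Y → ℕ) (hDY : ∀ y, D (Sum.inr y) = 0)
    (hDT : ∀ i, D (Sum.inl i) = D (T i) + 1) (lam : ℂ) (v : ι → ℂ)
    (heq : ∀ j, lam * v (σ j) =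
      w j * v j + ∑ k, if s k = k ∧ T k = Sum.inl (σ j) then v k else 0)
    (hC : ∀ y, (∑ k, if s k = k ∧ T k = Sum.inr y then v k else 0) = 0) : v = 0 := by
  by_contra hv
  obtain ⟨j₁, hj₁⟩ := Function.ne_iff.1 hv
  obtain ⟨c, hc, hmax⟩ := (Finset.univ.filter fun j => v j ≠ 0).exists_max_image
    (fun j => D (Sum.inl j)) ⟨j₁, by simpa using hj₁⟩
  simp only [Finset.mem_filter, Finset.mem_univ, true_and] at hc hmax
  have hD : ∀ i j, σ.SameCycle i j → D (Sum.inl i) = D (Sum.inl j) := fun i j hij => by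
    rw [hDT, hDT j, hT i j hij]
  have hσ : ∀ j, σ.SameCycle j (σ j) := fun j => ⟨1, by simp⟩
  have feed0 : ∀ z, (∀ k, T k = z → v k = 0) →
      (∑ k, if s k = k ∧ T k = z then v k else 0) = 0 := fun z hz =>
    Finset.sum_eq_zero fun k _ => by
      split_ifs with h
      · exact hz k h.2
      · rfl
  have noFeed : ∀ t, (∀ j, σ.SameCycle t j → ∀ k, T k = Sum.inl j → v k = 0) →
      ∀ j, σ.SameCycle t j → lam * v (σ j) = w t * v j := fun t ht j hj => by
    rw [heq, feed0 _ (ht _ (hj.trans (hσ j))), add_zero, (hw t j).2 hj]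
  have noFeed_norm : ∀ t, (∀ j, σ.SameCycle t j → ∀ k, T k = Sum.inl j → v k = 0) →
      v t ≠ 0 → ‖lam‖ = w t := fun t ht hvt =>
    cycle_norm_eq σ lam (w t) (hw0 t) v t hvt (noFeed t ht)
  -- A nonzero feeder would lie one level farther from the outputs than `c`.
  have top : ∀ t, D (Sum.inl t) = D (Sum.inl c) →
      ∀ j, σ.SameCycle t j → ∀ k, T k = Sum.inl j → v k = 0 := by
    intro t ht j hj k hk
    by_contra hvk
    have h1 := hmax k hvk
    rw [hDT k, hk, ← hD t j hj, ht] at h1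
    omega
  have hlamc : ‖lam‖ = w c := noFeed_norm c (top c rfl) hc
  have hlam : lam ≠ 0 := norm_pos_iff.1 (hlamc ▸ hw0 c)
  have hwc : ∀ t, (w t : ℂ) ≠ 0 := fun t => by exact_mod_cast (hw0 t).ne'
  -- Descent from the level of `c`: on each level `v` lives on exactly one cycle and vanishes
  -- nowhere on it.
  have key : ∀ d m, m + d = D (Sum.inl c) → 1 ≤ m → ∃ j, D (Sum.inl j) = m ∧
      (∀ i, σ.SameCycle j i → v i ≠ 0) ∧
      ∀ k, D (Sum.inl k) = m → v k ≠ 0 → σ.SameCycle j k := by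
    intro d
    induction d with
    | zero =>
      intro m hm _
      refine ⟨c, by omega, fun i hi => ?_, fun k hk hvk => ?_⟩
      · rw [Ne, cycle_dichotomy σ lam (w c) hlam (hwc c) v c
          (fun j hj _ => noFeed c (top c rfl) j hj) i hi]
        exact hc
      · rw [← hw, ← hlamc]
        exact noFeed_norm k (top k (by omega)) hvk
    | succ d ih =>
      intro m hm h1m
      obtain ⟨j, hjm, hj0, hju⟩ := ih (m + 1) (by omega) (by omega)
      have hTj : D (T j) = m := by have := hDT j; omega
      obtain ⟨t, ht⟩ | ⟨y, hy⟩ : (∃ t, T j = Sum.inl t) ∨ ∃ y, T j = Sum.inr y := by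
        cases T j <;> simp
      swap
      · rw [hy, hDY] at hTj
        omega
      rw [ht] at hTj
      have feeders : ∀ i, D (Sum.inl i) = m → ∀ k, T k = Sum.inl i → v k ≠ 0 →
          σ.SameCycle j k ∧ i = t := by
        intro i hi k hk hvk
        have hjk := hju k (by rw [hDT, hk, hi]) hvk
        refine ⟨hjk, ?_⟩
        have := hT j k hjk
        rw [ht, hk] at this
        exact (Sum.inl.inj this).symm
      have hfeed : (∑ k, if s k = k ∧ T k = Sum.inl t then v k else 0) = v (s j) := by
        rw [Finset.sum_eq_single (s j)]
        · rw [if_pos ⟨(hs' _ _ (hs j)).symm, by rw [← hT _ _ (hs j), ht]⟩]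
        · intro k _ hk
          split_ifs with h
          · by_contra hvk
            exact hk (h.1.symm.trans (hs' _ _ (feeders t hTj k h.2 hvk).1).symm)
          · rfl
        · simp
      refine ⟨t, hTj, ?_, fun k hk hvk => ?_⟩
      · have hcyc : ∀ i, σ.SameCycle t i → (v i = 0 ↔ v t = 0) :=
          cycle_dichotomy σ lam (w t) hlam (hwc t) v t fun i hi hit => by
            rw [heq, feed0, add_zero, (hw t i).2 hi]
            intro k hk
            by_contra hvk
            exact hit (feeders _ (by rw [← hD _ _ (hi.trans (hσ i)), hTj]) k hk hvk).2
        have hvt : v t ≠ 0 := by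
          -- Otherwise `v` vanishes on the whole cycle, and the equation at `t` leaves only the
          -- nonzero feed `v (s j)`.
          intro h0
          have hsymm : σ.SameCycle t (σ⁻¹ t) := ⟨-1, by simp⟩
          have h2 := heq (σ⁻¹ t)
          rw [(hcyc _ hsymm).2 h0, show σ (σ⁻¹ t) = t by simp, hfeed, h0] at h2
          exact hj0 _ (hs j) (by simpa using h2.symm)
        intro i hi
        rw [Ne, hcyc i hi]
        exact hvt
      -- A second cycle on this level is unfed, so it has the weight of `c`, hence is the cycle of
      -- `c`, which lies higher.
      · by_contra htk
        have h3 := noFeed_norm k (fun i hi k' hk' => by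
          by_contra hvk'
          have := (feeders i (by rw [← hD _ _ hi, hk]) k' hk' hvk').2
          exact htk (this ▸ hi.symm)) hvk
        rw [hlamc, hw] at h3
        have := hD _ _ h3
        omega
  obtain ⟨j, hj1, hj0, hju⟩ := key (D (Sum.inl c) - 1) 1
    (by have := hDT c; omega) le_rfl
  have hTj : D (T j) = 0 := by have := hDT j; omega
  obtain ⟨t, ht⟩ | ⟨y, hy⟩ : (∃ t, T j = Sum.inl t) ∨ ∃ y, T j = Sum.inr y := by
    cases T j <;> simp
  · rw [ht, hDT] at hTj
    omega
  refine hj0 _ (hs j) ?_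
  rw [← hC y, Finset.sum_eq_single (s j)]
  · rw [if_pos ⟨(hs' _ _ (hs j)).symm, by rw [← hT _ _ (hs j), hy]⟩]
  · intro k _ hk
    split_ifs with h
    · by_contra hvk
      exact hk (h.1.symm.trans (hs' _ _ (hju k (by rw [hDT, h.2, hDY]) hvk)).symm)
    · rfl
  · simp

end StructuredSystem
-- An observable pair inside the pattern
namespace StructuredSystem

/-- The eigenvector (Popov–Belevitch–Hautus) test over `ℂ`. -/
theorem isObservable_of_eigenvector {n : ℕ} {Y : Type} [Fintype Y]
    (A : Matrix (Fin n) (Fin n) ℝ) (C : Matrix Y (Fin n) ℝ)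
    (h : ∀ (lam : ℂ) (v : Fin n → ℂ), (A.map Complex.ofRealHom).mulVec v = lam • v →
      (C.map Complex.ofRealHom).mulVec v = 0 → v = 0) : IsObservable A C := by
  rw [isObservable_iff_forall_mulVec]
  intro v hv
  by_contra hv0
  set A' := A.map Complex.ofRealHom with hA'
  set C' := C.map Complex.ofRealHom with hC'
  -- The complexified unobservable subspace: invariant and nonzero, so it contains an eigenvector.
  let W : Submodule ℂ (Fin n → ℂ) := ⨅ k : ℕ, LinearMap.ker (C' * A' ^ k).mulVecLin
  have hW : ∀ u, u ∈ W ↔ ∀ k : ℕ, C'.mulVec ((A' ^ k).mulVec u) = 0 := fun u => by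
    simp [W, Submodule.mem_iInf]
  have hmaps : ∀ u ∈ W, A'.mulVecLin u ∈ W := by
    intro u hu
    rw [hW] at hu ⊢
    intro k
    have := hu (k + 1)
    rwa [pow_succ, ← Matrix.mulVec_mulVec] at this
  have hvW : (fun i => (v i : ℂ)) ∈ W := by
    rw [hW]
    intro k
    have h1 := congrArg (fun u : Y → ℝ => Complex.ofRealHom ∘ u) (hv k)
    funext y
    have h2 := congrFun h1 y
    rw [Matrix.mulVec_mulVec] at h2 ⊢
    rw [hA', hC', ← Matrix.map_pow, ← Matrix.map_mul]
    simp only [Function.comp_apply, RingHom.map_mulVec] at h2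
    simpa [Function.comp_def] using h2
  have : Nontrivial W := by
    refine ⟨⟨⟨_, hvW⟩, 0, fun h0 => hv0 ?_⟩⟩
    funext i
    have := congrFun (congrArg Subtype.val h0) i
    simpa using this
  obtain ⟨lam, hlam⟩ := Module.End.exists_eigenvalue (A'.mulVecLin.restrict hmaps)
  obtain ⟨u, hu⟩ := hlam.exists_hasEigenvector
  have hu1 : A'.mulVec u = lam • (u : Fin n → ℂ) := congrArg Subtype.val hu.apply_eq_smul
  have hu2 := (hW u).1 u.2 0
  rw [pow_zero, Matrix.one_mulVec] at hu2
  exact hu.2 (Subtype.ext (h lam u hu1 hu2))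

/-- A distance function to a set that is reachable from everywhere. -/
theorem exists_distance {α : Type*} (r : α → α → Prop) (P : α → Prop)
    (h : ∀ a, ∃ b, Relation.ReflTransGen r a b ∧ P b) :
    ∃ D : α → ℕ, (∀ a, P a → D a = 0) ∧ (∀ a, ¬ P a → ∃ b, r a b ∧ D a = D b + 1) ∧
      ∀ a b, r a b → D a ≤ D b + 1 := by
  classical
  let L : ℕ → α → Prop := fun k => Nat.rec (motive := fun _ => α → Prop) P (fun _ l a => ∃ b, r a b ∧ l b) k
  have hL : ∀ a, ∃ k, L k a := by
    intro a
    obtain ⟨b, hab, hb⟩ := h a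
    induction hab using Relation.ReflTransGen.head_induction_on with
    | refl => exact ⟨0, hb⟩
    | head hac _ ih =>
      obtain ⟨k, hk⟩ := ih
      exact ⟨k + 1, _, hac, hk⟩
  have hle : ∀ a b : α, r a b → Nat.find (hL a) ≤ Nat.find (hL b) + 1 := fun a b hab =>
    Nat.find_min' (hL a) (m := Nat.find (hL b) + 1) ⟨b, hab, Nat.find_spec (hL b)⟩
  refine ⟨fun a => Nat.find (hL a), fun a ha => (Nat.find_eq_zero (hL a)).2 ha,
    fun a ha => ?_, hle⟩
  have hspec := Nat.find_spec (hL a)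
  rcases hk : Nat.find (hL a) with _ | k
  · exact absurd ((Nat.find_eq_zero (hL a)).1 hk) ha
  · rw [hk] at hspec
    obtain ⟨b, hab, hb⟩ := hspec
    refine ⟨b, hab, ?_⟩
    have h1 := hle a b hab
    have h2 := Nat.find_min' (hL b) (m := k) hb
    change Nat.find (hL a) = Nat.find (hL b) + 1
    omega

/-- If the digraph has a cycle cover and every state reaches an output, then some observable
pair has its nonzero entries among those of `(A, C)`. -/
theorem exists_observable_subpattern {n : ℕ} {Y : Type} [Fintype Y]
    (A : Matrix (Fin n) (Fin n) ℝ) (C : Matrix Y (Fin n) ℝ) (σ : Equiv.Perm (Fin n))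
    (hσ : ∀ j, A (σ j) j ≠ 0)
    (hreach : ∀ j, ∃ y, Relation.ReflTransGen (systemDigraph A C).Adj (Sum.inl j) (Sum.inr y)) :
    ∃ (A' : Matrix (Fin n) (Fin n) ℝ) (C' : Matrix Y (Fin n) ℝ),
      (∀ i j, A i j = 0 → A' i j = 0) ∧ (∀ y j, C y j = 0 → C' y j = 0) ∧
      IsObservable A' C' := by
  classical
  -- Moving along a cycle of `σ` is free, so the distance `D` is constant on cycles.
  let r : Fin n ⊕ Y → Fin n ⊕ Y → Prop := fun a b =>
    ∃ j k, a = Sum.inl j ∧ σ.SameCycle j k ∧ (systemDigraph A C).Adj (Sum.inl k) b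
  obtain ⟨D, hD0, hD1, hD2⟩ := exists_distance r (fun a => ∃ y, a = Sum.inr y) (by
    rintro (j | y)
    · obtain ⟨y, hy⟩ := hreach j
      refine ⟨_, Relation.ReflTransGen.mono ?_ _ _ hy, y, rfl⟩
      rintro (a | a) b hab
      · exact ⟨a, a, rfl, Equiv.Perm.SameCycle.refl _ _, hab⟩
      · exact hab.elim
    · exact ⟨_, .refl, y, rfl⟩)
  have hstep : ∀ j, ∃ k z, σ.SameCycle j k ∧ (systemDigraph A C).Adj (Sum.inl k) z ∧
      D (Sum.inl j) = D z + 1 := by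
    intro j
    obtain ⟨z, ⟨j', k, hj, hk, hz⟩, hD⟩ := hD1 (Sum.inl j) (by simp)
    obtain rfl := Sum.inl.inj hj
    exact ⟨k, z, hk, hz, hD⟩
  choose s₀ T₀ hs₀ hT₀ hDT₀ using hstep
  -- Weights and exits are chosen through a representative, which makes them constant on cycles and
  -- the weights distinct between cycles.
  let ρ : Fin n → Fin n := fun i => (Quotient.mk (Equiv.Perm.SameCycle.setoid σ) i).out
  have hρ : ∀ i, σ.SameCycle i (ρ i) := fun i =>
    Setoid.symm' (Equiv.Perm.SameCycle.setoid σ) (Quotient.mk_out i)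
  have hρ' : ∀ i j, σ.SameCycle i j → ρ i = ρ j := fun i j hij =>
    congrArg Quotient.out (Quotient.sound (s := Equiv.Perm.SameCycle.setoid σ) hij)
  have hDσ : ∀ i j, σ.SameCycle i j → D (Sum.inl i) ≤ D (Sum.inl j) := by
    intro i j hij
    rw [hDT₀ j]
    exact hD2 _ _ ⟨i, s₀ j, rfl, hij.trans (hs₀ j), hT₀ j⟩
  let w : Fin n → ℝ := fun i => ((ρ i : ℕ) : ℝ) + 1
  have hw0 : ∀ i, 0 < w i := fun i => by positivity
  let s : Fin n → Fin n := fun i => s₀ (ρ i)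
  let T : Fin n → Fin n ⊕ Y := fun i => T₀ (ρ i)
  have hT : ∀ i, (systemDigraph A C).Adj (Sum.inl (s i)) (T i) := fun i => hT₀ (ρ i)
  refine ⟨Matrix.of fun i j => (if i = σ j then w j else 0) +
    (if s j = j ∧ T j = Sum.inl i then 1 else 0),
    Matrix.of fun y j => if s j = j ∧ T j = Sum.inr y then 1 else 0, ?_, ?_, ?_⟩
  · intro i j hij
    rw [Matrix.of_apply, if_neg (by rintro rfl; exact hσ j hij), if_neg, add_zero]
    rintro ⟨h1, h2⟩
    have := hT j
    rw [h1, h2] at this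
    exact this hij
  · intro y j hyj
    rw [Matrix.of_apply, if_neg]
    rintro ⟨h1, h2⟩
    have := hT j
    rw [h1, h2] at this
    exact this hyj
  · refine isObservable_of_eigenvector _ _ fun lam v hA hC => ?_
    refine eigenvector_eq_zero σ w hw0 (fun i j => ⟨fun hij => ?_, fun hij => ?_⟩) s
      (fun i => (hρ i).trans (hs₀ _)) (fun i j hij => congrArg s₀ (hρ' i j hij)) T
      (fun i j hij => congrArg T₀ (hρ' i j hij)) D (fun y => hD0 _ ⟨y, rfl⟩) (fun i => ?_)
      lam v (fun j => ?_) (fun y => ?_)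
    · have : ρ i = ρ j := by
        simp only [w, add_left_inj, Nat.cast_inj] at hij
        exact Fin.ext hij
      exact (hρ i).trans (this ▸ (hρ j).symm)
    · simp only [w, hρ' i j hij]
    · rw [((hDσ _ _ (hρ i)).antisymm (hDσ _ _ (hρ i).symm)), hDT₀]
    · have := congrFun hA (σ j)
      simp only [Matrix.mulVec, dotProduct, Matrix.map_apply, Matrix.of_apply, map_add,
        add_mul, Finset.sum_add_distrib, Pi.smul_apply, smul_eq_mul] at this
      rw [← this]
      congr 1
      · rw [Finset.sum_eq_single j]
        · simp
        · intro k _ hk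
          rw [if_neg fun h => hk (σ.injective h).symm, map_zero, zero_mul]
        · simp
      · refine Finset.sum_congr rfl fun k _ => ?_
        split_ifs <;> simp
    · have := congrFun hC y
      simp only [Matrix.mulVec, dotProduct, Matrix.map_apply, Matrix.of_apply,
        Pi.zero_apply] at this
      refine Eq.trans (Finset.sum_congr rfl fun k _ => ?_) this
      split_ifs <;> simp

/-! ### Genericity and the obstruction -/

/-- One observable pair with entries in the pattern makes the whole pattern generically
observable. -/
theorem genericallyObservable_of_exists {n : ℕ} {Y : Type} [Fintype Y]
    (A : Matrix (Fin n) (Fin n) ℝ) (C : Matrix Y (Fin n) ℝ)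
    (A' : Matrix (Fin n) (Fin n) ℝ) (C' : Matrix Y (Fin n) ℝ)
    (hA : ∀ i j, A i j = 0 → A' i j = 0) (hC : ∀ y j, C y j = 0 → C' y j = 0)
    (hobs : IsObservable A' C') : GenericallyObservable A C := by
  classical
  let 𝒜 : Matrix (Fin n) (Fin n) (MvPolynomial (Param A C) ℝ) := Matrix.of fun i j =>
    if h : A i j ≠ 0 then MvPolynomial.X (Sum.inl ⟨(i, j), h⟩) else 0
  let 𝒞 : Matrix Y (Fin n) (MvPolynomial (Param A C) ℝ) := Matrix.of fun y j =>
    if h : C y j ≠ 0 then MvPolynomial.X (Sum.inr ⟨(y, j), h⟩) else 0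
  let O : Matrix (Fin n) (Fin n × Y) (MvPolynomial (Param A C) ℝ) :=
    Matrix.of fun x ky => (𝒜.transpose ^ (ky.1 : ℕ) * 𝒞.transpose) x ky.2
  have hO : ∀ θ : Param A C → ℝ, MvPolynomial.eval θ (O * O.transpose).det ≠ 0 ↔
      IsObservable (fill A fun e => θ (Sum.inl e)) (fill C fun e => θ (Sum.inr e)) := by
    intro θ
    have h𝒜 : 𝒜.map (MvPolynomial.eval θ) = fill A fun e => θ (Sum.inl e) := by
      ext i j
      simp only [𝒜, fill, Matrix.map_apply, Matrix.of_apply]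
      split_ifs <;> simp
    have h𝒞 : 𝒞.map (MvPolynomial.eval θ) = fill C fun e => θ (Sum.inr e) := by
      ext i j
      simp only [𝒞, fill, Matrix.map_apply, Matrix.of_apply]
      split_ifs <;> simp
    have hOθ : O.map (MvPolynomial.eval θ) = observabilityMatrix
        (fill A fun e => θ (Sum.inl e)) (fill C fun e => θ (Sum.inr e)) := by
      ext x ky
      rw [observabilityMatrix, Matrix.of_apply, ← h𝒜, ← h𝒞, ← Matrix.transpose_map,
        ← Matrix.transpose_map, ← Matrix.map_pow, ← Matrix.map_mul]
      rfl
    rw [isObservable_iff_det_ne_zero, ← hOθ, ← Matrix.transpose_map, ← Matrix.map_mul,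
      RingHom.map_det]
    rfl
  refine ⟨(O * O.transpose).det, MvPolynomial.volume_zeros _ fun h0 => ?_,
    fun θ hθ => (hO θ).1 hθ⟩
  let θ : Param A C → ℝ :=
    Sum.elim (fun e => A' e.1.1 e.1.2) (fun e => C' e.1.1 e.1.2)
  refine (hO θ).2 ?_ (by rw [h0, map_zero])
  have h1 : (fill A fun e => θ (Sum.inl e)) = A' := by
    ext i j
    simp only [fill, Matrix.of_apply, θ, Sum.elim_inl]
    split_ifs with h
    · rfl
    · exact (hA i j (not_not.1 h)).symm
  have h2 : (fill C fun e => θ (Sum.inr e)) = C' := by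
    ext i j
    simp only [fill, Matrix.of_apply, θ, Sum.elim_inr]
    split_ifs with h
    · rfl
    · exact (hC i j (not_not.1 h)).symm
  rwa [h1, h2]

/-- A nonempty set of states without edges leaving it and without edges to the outputs prevents
observability. -/
theorem not_isObservable_of_closed {n : ℕ} {Y : Type} [Fintype Y]
    (A : Matrix (Fin n) (Fin n) ℝ) (C : Matrix Y (Fin n) ℝ) (K : Set (Fin n)) (hK : K.Nonempty)
    (hA : ∀ u ∈ K, ∀ v, v ∉ K → A v u = 0) (hC : ∀ u ∈ K, ∀ y, C y u = 0) :
    ¬ IsObservable A C := by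
  classical
  rw [isObservable_iff_forall_mulVec]
  intro h
  obtain ⟨x, hx⟩ := hK
  -- The orbit of a basis vector of `K` stays supported in `K`, where `C` is blind.
  have hsupp : ∀ (k : ℕ) (v : Fin n), v ∉ K → ((A ^ k).mulVec (Pi.single x 1)) v = 0 := by
    intro k
    induction k with
    | zero =>
      intro v hv
      rw [pow_zero, Matrix.one_mulVec, Pi.single_eq_of_ne]
      rintro rfl
      exact hv hx
    | succ k ih =>
      intro v hv
      rw [pow_succ', ← Matrix.mulVec_mulVec]
      refine Finset.sum_eq_zero (fun u _ => ?_ : ∀ u ∈ Finset.univ,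
        A v u * ((A ^ k).mulVec (Pi.single x 1)) u = 0)
      by_cases hu : u ∈ K
      · rw [hA u hu v hv, zero_mul]
      · rw [ih u hu, mul_zero]
  have h1 := h (Pi.single x 1) fun k => by
    funext y
    refine Finset.sum_eq_zero (fun u _ => ?_ : ∀ u ∈ Finset.univ,
      C y u * ((A ^ k).mulVec (Pi.single x 1)) u = 0)
    by_cases hu : u ∈ K
    · rw [hC u hu y, zero_mul]
    · rw [hsupp k u hu, mul_zero]
  simpa using congrFun h1 x

theorem GenericallyObservable.exists_isObservable {n : ℕ} {Y : Type} [Fintype Y]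
    {A : Matrix (Fin n) (Fin n) ℝ} {C : Matrix Y (Fin n) ℝ} (h : GenericallyObservable A C) :
    ∃ θ : Param A C → ℝ,
      IsObservable (fill A fun e => θ (Sum.inl e)) (fill C fun e => θ (Sum.inr e)) := by
  classical
  obtain ⟨q, hq, h⟩ := h
  by_contra! hno
  have : {θ : Param A C → ℝ | MvPolynomial.eval θ q = 0} = Set.univ :=
    Set.eq_univ_of_forall fun θ => by
      by_contra hθ
      exact hno θ (h θ hθ)
  rw [this] at hq
  exact NeZero.ne _ (MeasureTheory.Measure.measure_univ_eq_zero.1 hq)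

/-! ### Cycle cover and parent SCCs -/

theorem exists_perm_of_sRank_eq {n : ℕ} (A : Matrix (Fin n) (Fin n) ℝ) (hA : sRank A = n) :
    ∃ σ : Equiv.Perm (Fin n), ∀ j, A (σ j) j ≠ 0 := by
  have hmem := Nat.sSup_mem (s := {k | ∃ M' : Matrix (Fin n) (Fin n) ℝ,
    SameStructure A M' ∧ M'.rank = k}) ⟨_, A, fun _ _ => Iff.rfl, rfl⟩
    ⟨n, by rintro _ ⟨M, _, rfl⟩; simpa using M.rank_le_width⟩
  obtain ⟨M, hM, hr⟩ := hmem
  change M.rank = sRank A at hr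
  have hdet : M.det ≠ 0 := by
    intro h0
    obtain ⟨v, hv, hMv⟩ := Matrix.exists_mulVec_eq_zero_iff.2 h0
    have hrange : LinearMap.range M.mulVecLin = ⊤ := Submodule.eq_top_of_finrank_eq (by
      simpa [Matrix.rank, hA] using hr)
    have hi := LinearMap.injective_iff_surjective.2 (LinearMap.range_eq_top.1 hrange)
    exact hv (hi (by simpa using hMv))
  rw [Matrix.det_apply] at hdet
  obtain ⟨σ, _, hσ⟩ := Finset.exists_ne_zero_of_sum_ne_zero hdet
  refine ⟨σ, fun j hj => hσ ?_⟩
  have hprod : ∏ i, M (σ i) i = 0 := Finset.prod_eq_zero (Finset.mem_univ j) ((hM _ _).2 hj)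
  exact (congrArg (Equiv.Perm.sign σ • ·) hprod).trans (smul_zero _)

theorem reflTransGen_restrict {V : Type*} {r : V → V → Prop} {S : Set V}
    (hS : ∀ a ∈ S, ∀ b, r a b → b ∈ S) {a b : V} (hab : Relation.ReflTransGen r a b)
    (ha : a ∈ S) : b ∈ S ∧ Relation.ReflTransGen (fun a b => a ∈ S ∧ b ∈ S ∧ r a b) a b := by
  induction hab with
  | refl => exact ⟨ha, .refl⟩
  | tail _ hbc ih => exact ⟨hS _ ih.1 _ hbc, ih.2.tail ⟨ih.1, hS _ ih.1 _ hbc, hbc⟩⟩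

/-- From every state a parent SCC is reachable. -/
theorem exists_isParentSCC_reachable {n : ℕ} {Y : Type} (A : Matrix (Fin n) (Fin n) ℝ)
    (C : Matrix Y (Fin n) ℝ) (x : Fin n) :
    ∃ K : Set (Fin n), IsParentSCC A C K ∧
      ∀ v ∈ K, Relation.ReflTransGen (systemDigraph A C).Adj (Sum.inl x) (Sum.inl v) := by
  let r : Fin n → Fin n → Prop := fun a b => (systemDigraph A C).Adj (Sum.inl a) (Sum.inl b)
  let R : Fin n → Set (Fin n) := fun u => {v | Relation.ReflTransGen r u v}
  have hlift : ∀ {a b}, Relation.ReflTransGen r a b →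
      Relation.ReflTransGen (systemDigraph A C).Adj (Sum.inl a) (Sum.inl b) :=
    fun h => Relation.ReflTransGen.lift Sum.inl (fun _ _ h => h) _ _ h
  -- A smallest reachable set is a parent SCC: each of its members reaches just as much, hence also
  -- `u`.
  obtain ⟨u, hu, hmin⟩ := (R x).toFinite.exists_minimalFor (fun u => (R u).ncard) (R x)
    ⟨x, .refl⟩
  have hclosed : ∀ a ∈ R u, ∀ b, r a b → b ∈ R u := fun a ha b hab =>
    Relation.ReflTransGen.tail ha hab
  have hback : ∀ v ∈ R u, Relation.ReflTransGen r v u := by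
    intro v hv
    have hsub : R v ⊆ R u := fun z hz => Relation.ReflTransGen.trans hv hz
    have hle := hmin (Relation.ReflTransGen.trans hu hv) (Set.ncard_le_ncard hsub)
    have := Set.eq_of_subset_of_ncard_le hsub hle
    have hmem : u ∈ R v := this ▸ Relation.ReflTransGen.refl
    exact hmem
  refine ⟨R u, ⟨⟨⟨⟨_, u, .refl, rfl⟩, ?_⟩, ?_⟩, fun a ha b hb hab => hb (hclosed a ha b hab)⟩,
    fun v hv => hlift (Relation.ReflTransGen.trans hu hv)⟩
  · rintro _ ⟨a, ha, rfl⟩ _ ⟨b, hb, rfl⟩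
    have hab := (reflTransGen_restrict hclosed ((hback a ha).trans hb) ha).2
    exact Relation.ReflTransGen.lift Sum.inl
      (fun c d h => ⟨⟨c, h.1, rfl⟩, ⟨d, h.2.1, rfl⟩, h.2.2⟩) _ _ hab
  · rintro S ⟨_, hS⟩ hle z hz
    have huS : Sum.inl u ∈ S := hle ⟨u, .refl, rfl⟩
    have hmono : ∀ a b : Fin n ⊕ Y, a ∈ S ∧ b ∈ S ∧ (systemDigraph A C).Adj a b →
        (systemDigraph A C).Adj a b := fun _ _ h => h.2.2
    have h1 := Relation.ReflTransGen.mono hmono _ _ (hS _ huS z hz)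
    have h2 := Relation.ReflTransGen.mono hmono _ _ (hS z hz _ huS)
    rcases z with z | y
    -- Maximality: paths from `u` can leave `R u` only into outputs, which are dead ends.
    · have hinv : (Sum.inl z : Fin n ⊕ Y) ∈ Sum.inl '' R u ∪ Set.range Sum.inr :=
        (reflTransGen_restrict (fun a ha b hab => by
          rcases ha with ⟨a, ha, rfl⟩ | ⟨y, rfl⟩
          · rcases b with b | y
            · exact Or.inl ⟨b, hclosed a ha b hab, rfl⟩
            · exact Or.inr ⟨y, rfl⟩
          · exact hab.elim) h1 (Or.inl ⟨u, .refl, rfl⟩)).1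
      rcases hinv with h | ⟨y, hy⟩
      · exact h
      · cases hy
    · rcases h2.cases_head with h | ⟨c, hc, _⟩
      · cases h
      · exact hc.elim

end StructuredSystem

theorem mainTheorem6 (n N : ℕ) (p : Fin N → ℕ) (A : Matrix (Fin n) (Fin n) ℝ)
    (C : ∀ i : Fin N, Matrix (Fin (p i)) (Fin n) ℝ)
    (hA : StructuredSystem.sRank A = n) :
    StructuredSystem.GenericallyObservable A (StructuredSystem.globalOutput C) ↔
      ∀ K : Set (Fin n), StructuredSystem.IsParentSCC A (StructuredSystem.globalOutput C) K →
        ∃ i : Fin N, StructuredSystem.Monitors A C i K := by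
  open StructuredSystem in
  constructor
  · intro h K hK
    by_contra! hno
    obtain ⟨θ, hθ⟩ := h.exists_isObservable
    refine not_isObservable_of_closed _ _ K (Set.image_nonempty.1 hK.1.1.1) ?_ ?_ hθ
    · intro u hu v hv
      exact dif_neg (hK.2 u hu v hv)
    · intro u hu y
      exact dif_neg fun hy => hno y.1 ⟨u, hu, y.2, hy⟩
  · intro h
    obtain ⟨σ, hσ⟩ := exists_perm_of_sRank_eq A hA
    obtain ⟨A', C', hA', hC', hobs⟩ := exists_observable_subpattern A (globalOutput C) σ hσ
      fun j => by
        obtain ⟨K, hK, hjK⟩ := exists_isParentSCC_reachable A (globalOutput C) j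
        obtain ⟨i, x, hx, r, hr⟩ := h K hK
        exact ⟨⟨i, r⟩, (hjK x hx).tail hr⟩
    exact genericallyObservable_of_exists A _ A' C' hA' hC' hobs
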